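/- For a prime $p$, identify $\mathbb{F}_p$ with $\{0,1,\ldots,p-1\}$ and let $\psi_p:\mathbb{F}_p\to\mathbb{F}_p$ be the map $\psi_p(x)= x^x \bmod p$ (with $0^0=1$). Let $F_p\in\mathbb{F}_p[X]$ be the unique polynomial of degree at most $p-1$ with $F_p(x)=\psi_p(x)$ for all $x\in\mathbb{F}_p$, and let $D_p=\deg F_p$. Then, as $p\to\infty$ over the primes, $$D_p\ \ge\ \left(\sqrt{2-\sqrt3}+o(1)\right)p^{1/2},$$ where $\sqrt{2-\sqrt3}=0.5176\ldots$. That is, there is a function $\varepsilon:\mathbb{N}\to\mathbb{R}$ with $\varepsilon(n)\to0$ as $n\to\infty$ such that $D_p\ge\left(\sqrt{2-\sqrt3}+\varepsilon(p)\right)p^{1/2}$ for every prime $p$. -/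

import Mathlib

open Filter Topology Polynomial

/-- The self-power map `x ↦ x ^ x` on `𝔽_p`, where the exponent is the representative of `x` in
`{0, …, p - 1}` (so `0` is sent to `0 ^ 0 = 1`). -/
def selfPowerMap (p : ℕ) (x : ZMod p) : ZMod p := x ^ x.val

/-- The Lagrange interpolation polynomial `F_p` of degree at most `p - 1` of the self-power map. -/
noncomputable def selfPowerPoly (p : ℕ) [Fact p.Prime] : (ZMod p)[X] :=
  Lagrange.interpolate Finset.univ id (selfPowerMap p)

/-- The degree `D_p` of the interpolation polynomial `F_p`. -/
noncomputable def selfPowerDegree (p : ℕ) [Fact p.Prime] : ℕ := (selfPowerPoly p).natDegree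

/-- `F_p` is the unique polynomial of degree less than `p` with `F_p(x) = x ^ x` on `𝔽_p`. -/
theorem eq_selfPowerPoly_iff (p : ℕ) [Fact p.Prime] (F : (ZMod p)[X]) :
    F = selfPowerPoly p ↔ F.degree < p ∧ ∀ x : ZMod p, F.eval x = selfPowerMap p x := by
  have h := Lagrange.eq_interpolate_iff (s := Finset.univ) (v := (id : ZMod p → ZMod p))
    (f := F) (r := selfPowerMap p) (Set.injOn_id _)
  simp only [Finset.card_univ, ZMod.card, Finset.mem_univ, id_eq, forall_true_left] at h
  exact h.symm

/-!
The bound proved here is linear in `p`, hence stronger than the required one of order `√p`.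

As long as the representatives stay below `p`, one has `(2n)^(2n) = 4^n * (n^n)^2`, so the quotient
`F(2X) / F(X)^2` of values of the interpolation polynomial `F` agrees with `4^n` at `n < p/2`.
Eliminating the exponential between `n` and `n + 1` shows that
`F(2X + 2) * F(X)^2 - 4 * F(2X) * F(X + 1)^2` vanishes at the `(p - 1)/2` points with
`2n + 2 < p`. Its degree is at most `3 * deg F`. It is not the zero polynomial: both
products have the same nonzero leading coefficient up to the factor `4`, and `4 ≠ 1` in `𝔽_p` for
`p > 3`. Hence `3 * deg F ≥ (p - 1)/2` (`sub_one_le_six_mul_selfPowerDegree`), which exceeds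
`√(2 - √3) * √p` as soon as `p ≥ 100`.
-/

theorem eval_selfPowerPoly (p : ℕ) [Fact p.Prime] (x : ZMod p) :
    (selfPowerPoly p).eval x = selfPowerMap p x :=
  ((eq_selfPowerPoly_iff p _).1 rfl).2 x

theorem eval_selfPowerPoly_natCast {p n : ℕ} [Fact p.Prime] (hn : n < p) :
    (selfPowerPoly p).eval (n : ZMod p) = (n : ZMod p) ^ n := by
  rw [eval_selfPowerPoly, selfPowerMap, ZMod.val_cast_of_lt hn]

theorem selfPowerPoly_ne_zero (p : ℕ) [Fact p.Prime] : selfPowerPoly p ≠ 0 := by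
  intro h
  have h0 := eval_selfPowerPoly p 0
  simp [h, selfPowerMap] at h0

/-- The values of the self-power map at `n`, `n + 1`, `2n` and `2n + 2` satisfy a polynomial
relation, because `(2n)^(2n) / (n^n)^2 = 4^n` is a geometric progression. -/
theorem eval_selfPowerPoly_relation {p n : ℕ} [Fact p.Prime] (hn : 2 * n + 2 < p) :
    (selfPowerPoly p).eval (2 * (n : ZMod p) + 2) * (selfPowerPoly p).eval (n : ZMod p) ^ 2 =
      4 * ((selfPowerPoly p).eval (2 * (n : ZMod p)) *
        (selfPowerPoly p).eval ((n : ZMod p) + 1) ^ 2) := by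
  have h1 := eval_selfPowerPoly_natCast (p := p) (n := n) (by omega)
  have h2 := eval_selfPowerPoly_natCast (p := p) (n := n + 1) (by omega)
  have h3 := eval_selfPowerPoly_natCast (p := p) (n := 2 * n) (by omega)
  have h4 := eval_selfPowerPoly_natCast (p := p) (n := 2 * (n + 1)) (by omega)
  push_cast at h1 h2 h3 h4
  rw [show 2 * (n : ZMod p) + 2 = 2 * ((n : ZMod p) + 1) by ring, h1, h2, h3, h4,
    mul_pow, mul_pow, pow_mul, pow_mul (2 : ZMod p) 2 n]
  ring

/-- A nonzero polynomial `F` over a field in which `2` and `3` are invertible does not satisfy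
`F(2X + 2) F(X)^2 = 4 F(2X) F(X + 1)^2`: the leading coefficients differ by the factor `4`. -/
theorem comp_mul_sq_ne {K : Type*} [Field K] (h2 : (2 : K) ≠ 0) (h3 : (3 : K) ≠ 0) {F : K[X]}
    (hF : F ≠ 0) :
    F.comp (C 2 * X + C 2) * F ^ 2 ≠ C 4 * (F.comp (C 2 * X) * F.comp (X + C 1) ^ 2) := by
  intro h
  have h := congrArg leadingCoeff h
  simp only [leadingCoeff_mul, leadingCoeff_pow, leadingCoeff_C] at h
  rw [leadingCoeff_comp (by rw [natDegree_linear h2]; exact one_ne_zero),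
    leadingCoeff_comp (by rw [natDegree_C_mul_X _ h2]; exact one_ne_zero),
    leadingCoeff_comp (by rw [natDegree_X_add_C]; exact one_ne_zero),
    leadingCoeff_linear h2, leadingCoeff_C_mul_X, leadingCoeff_X_add_C, one_pow, mul_one] at h
  have hF' : F.leadingCoeff ≠ 0 := leadingCoeff_ne_zero.2 hF
  have hne : (3 : K) * (F.leadingCoeff * 2 ^ F.natDegree * F.leadingCoeff ^ 2) ≠ 0 := by
    positivity
  exact hne (by linear_combination -h)

/-- The degree `D_p` grows at least linearly. -/
theorem sub_one_le_six_mul_selfPowerDegree {p : ℕ} [Fact p.Prime] (hp : 3 < p) :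
    p - 1 ≤ 6 * selfPowerDegree p := by
  have hodd : p % 2 = 1 := (Fact.out : p.Prime).eq_two_or_odd.resolve_left (by omega)
  have hcast : ∀ m : ℕ, 0 < m → m < p → (m : ZMod p) ≠ 0 := fun m h0 hm h =>
    absurd (Nat.le_of_dvd h0 ((ZMod.natCast_eq_zero_iff m p).1 h)) (by omega)
  by_contra! hlt
  unfold selfPowerDegree at hlt
  set F := selfPowerPoly p
  refine comp_mul_sq_ne (F := F) (by exact_mod_cast hcast 2 (by omega) (by omega))
    (by exact_mod_cast hcast 3 (by omega) hp) (selfPowerPoly_ne_zero p) (sub_eq_zero.1 ?_)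
  -- The points `n < (p - 1)/2` are exactly those with `2 * n + 2 < p`, as `p` is odd.
  refine eq_zero_of_natDegree_lt_card_of_eval_eq_zero (ι := Fin ((p - 1) / 2))
    (f := fun i => ((i : ℕ) : ZMod p)) _ ?_ ?_ ?_
  · intro i j hij
    have h := congrArg ZMod.val hij
    simp only at h
    rw [ZMod.val_cast_of_lt (by omega), ZMod.val_cast_of_lt (by omega)] at h
    exact Fin.ext h
  · intro i
    have h := eval_selfPowerPoly_relation (p := p) (n := i) (by omega)
    simp only [eval_sub, eval_mul, eval_pow, eval_comp, eval_add, eval_C, eval_X]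
    exact sub_eq_zero.2 h
  · rw [Fintype.card_fin]
    have hcomp : ∀ G : (ZMod p)[X], G.natDegree ≤ 1 → (F.comp G).natDegree ≤ F.natDegree :=
      fun G hG => natDegree_comp_le.trans (by nlinarith)
    have a1 := hcomp (C 2 * X + C 2) natDegree_linear_le
    have a2 := hcomp (C 2 * X) ((natDegree_C_mul_le 2 X).trans natDegree_X_le)
    have a3 := hcomp (X + C 1) (natDegree_X_add_C 1).le
    have b1 : (F.comp (C 2 * X + C 2) * F ^ 2).natDegree ≤ F.natDegree + 2 * F.natDegree :=
      natDegree_mul_le_of_le a1 (natDegree_pow_le_of_le 2 le_rfl)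
    have b2 : (C 4 * (F.comp (C 2 * X) * F.comp (X + C 1) ^ 2)).natDegree ≤
        F.natDegree + 2 * F.natDegree :=
      (natDegree_C_mul_le _ _).trans
        (natDegree_mul_le_of_le a2 (natDegree_pow_le_of_le 2 a3))
    have := natDegree_sub_le_of_le b1 b2
    rw [max_self] at this
    omega

theorem sqrt_two_sub_sqrt_three_bounds :
    (0.5176 : ℝ) ≤ Real.sqrt (2 - Real.sqrt 3) ∧ Real.sqrt (2 - Real.sqrt 3) < 0.5177 := by
  have h1 : Real.sqrt 3 ≤ 1.73206 := Real.sqrt_le_iff.2 (by norm_num)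
  have h2 : 1.73205 < Real.sqrt 3 := Real.lt_sqrt_of_sq_lt (by norm_num)
  refine ⟨Real.le_sqrt_of_sq_le ?_, (Real.sqrt_lt' (by norm_num)).2 ?_⟩
  · norm_num at *; linarith
  · norm_num at *; linarith

theorem mainTheorem3 :
    (∃ ε : ℕ → ℝ, Tendsto ε atTop (𝓝 0) ∧
      ∀ (p : ℕ) [Fact p.Prime],
        (Real.sqrt (2 - Real.sqrt 3) + ε p) * (p : ℝ) ^ (1 / 2 : ℝ) ≤ (selfPowerDegree p : ℝ)) ∧
    (0.5176 : ℝ) ≤ Real.sqrt (2 - Real.sqrt 3) ∧ Real.sqrt (2 - Real.sqrt 3) < 0.5177 := by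
  refine ⟨?_, sqrt_two_sub_sqrt_three_bounds⟩
  -- The linear bound suffices from `p = 100` on; below, `ε p` makes the left side vanish.
  refine ⟨fun n => if n < 100 then -Real.sqrt (2 - Real.sqrt 3) else 0, ?_, ?_⟩
  · refine tendsto_const_nhds.congr' ?_
    filter_upwards [eventually_ge_atTop 100] with n hn
    rw [if_neg (by omega)]
  · intro p _
    rw [← Real.sqrt_eq_rpow]
    by_cases hp : p < 100
    · simp [hp]
    · simp only [if_neg hp, add_zero]
      have hD : (p : ℝ) ≤ 6 * selfPowerDegree p + 1 := by
        have := sub_one_le_six_mul_selfPowerDegree (p := p) (by omega)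
        exact_mod_cast (by omega : p ≤ 6 * selfPowerDegree p + 1)
      have hp' : (100 : ℝ) ≤ p := by exact_mod_cast not_lt.1 hp
      have h10 : 10 ≤ Real.sqrt p := Real.le_sqrt_of_sq_le (by linarith)
      have hsq : Real.sqrt p * Real.sqrt p = p := Real.mul_self_sqrt (by linarith)
      have hc := sqrt_two_sub_sqrt_three_bounds.2
      calc Real.sqrt (2 - Real.sqrt 3) * Real.sqrt p ≤ 1 * Real.sqrt p := by
            gcongr; linarith
        _ ≤ selfPowerDegree p := by nlinarith
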